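/- Let $H_T=\mathbb C[T,T^{-1}]$ with $T^n$ group-like, antipode $S(T^n)=T^{-n}$ and augmentation ideal $\mathfrak m=\ker(\epsilon)$, $\epsilon(T^n)=1$. Put $\Delta[n]=(T-1)^n/n!$ for $n\ge 0$ and $\Delta[-k]=(1-T^{-1})^k/k!$ for $k>0$; this is a basis of $H_T$, and $\Delta^*[n]\in H_T^*$ denotes its dual functionals. We identify $H_T^*$ with the space $\mathbb C^{\mathbb Z}$ of two-sided sequences, $s\in H_T^*$ corresponding to $(s(T^n))_{n\in\mathbb Z}$. Let $\tau=(n)_{n\in\mathbb Z}$, let $\mathbb C[\tau]\subset\mathbb C^{\mathbb Z}$ be the algebra of polynomial sequences with $(T^k s)_n=s_{n+k}$, and let $K$ be its localization at the multiplicative set generated by the translates $T^k\tau$, $k\in\mathbb Z$, with the induced action $T^k(f/g)=T^kf/T^kg$. Then $K=\mathbb C[\tau]\oplus K_{\mathrm{Sing}}$, where $K_{\mathrm{Sing}}$ has basis $T^{-n}\tau^{-l-1}=(\tau-n)^{-l-1}$ ($n\in\mathbb Z$, $l\ge0$); let $\mathrm{Sing}$ be the projection onto $K_{\mathrm{Sing}}$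 along $\mathbb C[\tau]$, which factors through $K/\mathbb C[\tau]$. The space $H_T^*$ acts on $K/\mathbb C[\tau]\cong K_{\mathrm{Sing}}$ by $s.(\tau-n)^{-l-1}=s(T^n)\,(\tau-n)^{-l-1}$. An $H_T$-conformal algebra is an $H_T$-module $C$ (over $\mathbb C$) with bilinear products $(f,g)\mapsto f_ng$, $n\in\mathbb Z$, such that for all $f,g\in C$ and $m,n,p\in\mathbb Z$: $f_ng=0$ for all but finitely many $n$; $(T^pf)_n=f_{n+p}$; $f_ng=-T^n(g_{-n}f)$; $[f_m,g_n]=(f_{m-n}g)_n$. Put $f_{\langle n\rangle}g=\sum_k\Delta^*[n](T^k)\,f_kg$. The singular vertex operator of $C$ is $$Y_{\mathrm{Sing}}(f,\tau)g=\sum_n f_ng\otimes S(T^n)\tfrac1\tau=\sum_n f_{\langle n\rangle}g\otimes S(\Delta[n])\tfrac1\tau\in C\otimes K .$$ For $p,q\in K$ let $Y_{\mathrm{Hol}}(p,\tau)q=\sum_n\Delta[n](p)\,q\otimes\Delta^*[n]$, i.e. the $K$-valued functional $h\mapsto h(p)q$ on $H_T$. Let $C$ be an $H_T$-conformal algebra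 and let $LC=C\otimes K$ be its affinization, with $H_T$ acting through the coproduct. For $f,g\in C$, $p,q\in K$ put $$Y^{LC}_{\mathrm{Sing}}(f\otimes p,\tau)(g\otimes q)=\mathrm{Sing}\bigl(Y_{\mathrm{Sing}}(f,\tau)g\mathbin{\dot\otimes}Y_{\mathrm{Hol}}(p,\tau)q\bigr)=\mathrm{Sing}\sum_{m,n}\bigl(f_{\langle m\rangle}g\otimes\Delta[n](p)q\bigr)\otimes\Delta^*[n].S(\Delta[m])\tfrac1\tau .$$ Then $Y^{LC}_{\mathrm{Sing}}$ gives $LC$ the structure of an $H_T$-conformal algebra: there is a unique $H_T$-conformal algebra structure on the $H_T$-module $LC$ whose singular vertex operator takes the value $Y^{LC}_{\mathrm{Sing}}(f\otimes p,\tau)(g\otimes q)$ on $f\otimes p$ and $g\otimes q$, for all $f,g\in C$ and $p,q\in K$. As a result, writing $\mathcal LC=LC/\mathfrak m LC$, $\mathrm{Tr}\colon LC\to\mathcal LC$ for the projection and $f_{\{p\}}=\mathrm{Tr}(f\otimes p)$, the formula $[\mathrm{Tr}\,x,\mathrm{Tr}\,y]=\mathrm{Tr}(x_{\langle0\rangle}y)$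 $(x,y\in LC)$ is a well-defined Lie bracket over $\mathbb C$ on $\mathcal LC$, and for all $f,g\in C$, $p,q\in K$ $$[f_{\{p\}},g_{\{q\}}]=\sum_{n\in\mathbb Z}\bigl(f_{\langle n\rangle}g\bigr)_{\{\Delta[n](p)\,q\}},$$ a finite sum. -/

import Mathlib

open scoped TensorProduct LaurentPolynomial

noncomputable section

namespace HTConf

/-! ### The Hopf algebra `H_T` -/

/-- The Hopf algebra `H_T = ℂ[T, T⁻¹]` (Mathlib's Hopf algebra structure has `T ^ n` group-like,
counit `T ^ n ↦ 1` and antipode `T ^ n ↦ T ^ (-n)`). -/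
abbrev HT : Type := ℂ[T;T⁻¹]

/-- The power `T ^ n`, `n ∈ ℤ`, of the translation operator. -/
abbrev Tp (n : ℤ) : HT := LaurentPolynomial.T n

/-- The antipode of `H_T`. -/
abbrev antip : HT →ₗ[ℂ] HT := HopfAlgebra.antipode ℂ (A := HT)

/-- The difference operators `Δ[n] = (T - 1) ^ n / n!` for `n ≥ 0` and
`Δ[-k] = (1 - T⁻¹) ^ k / k!` for `k > 0`. -/
def delta : ℤ → HT
  | Int.ofNat n => (n.factorial : ℂ)⁻¹ • (Tp 1 - 1) ^ n
  | Int.negSucc j => ((j + 1).factorial : ℂ)⁻¹ • (1 - Tp (-1)) ^ (j + 1)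

/-- The dual sequences `Δ*[m] ∈ H_T^* = ℂ^ℤ` of the basis `Δ[m]` (a sequence `s` is the functional
`T ^ n ↦ s n`): `Δ*[0] = 1`; for `m > 0`, `Δ*[m] n = n (n-1) ⋯ (n-m+1)` if `n ≥ 0` and `0` if
`n < 0`; for `m = -k < 0`, `Δ*[m] n = n (n+1) ⋯ (n+k-1)` if `n ≤ 0` and `0` if `n > 0`. -/
def deltaDual : ℤ → ℤ → ℂ
  | Int.ofNat m, n => if m = 0 ∨ 0 ≤ n then ∏ j ∈ Finset.range m, ((n : ℂ) - j) else 0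
  | Int.negSucc k, n => if n ≤ 0 then ∏ j ∈ Finset.range (k + 1), ((n : ℂ) + j) else 0

/-- The augmentation ideal of `H_T`, the kernel of the counit. -/
def augIdeal : Ideal HT := RingHom.ker (Bialgebra.counitAlgHom ℂ HT)

/-! ### The localization `K` -/

/-- The sequence `τ = (n)_{n ∈ ℤ}`. -/
def tau : ℤ → ℂ := fun n => n

/-- The algebra of polynomial sequences, generated by `τ`. -/
def Czpol : Subalgebra ℂ (ℤ → ℂ) := Algebra.adjoin ℂ {tau}

/-- The action of `T ^ k` on sequences, `(T ^ k s) n = s (n + k)`. -/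
def shiftSeq (k : ℤ) : (ℤ → ℂ) →ₐ[ℂ] (ℤ → ℂ) where
  toFun s n := s (n + k)
  map_one' := rfl
  map_mul' _ _ := rfl
  map_zero' := rfl
  map_add' _ _ := rfl
  commutes' _ := rfl

theorem shiftSeq_mem (k : ℤ) {s : ℤ → ℂ} (hs : s ∈ Czpol) : shiftSeq k s ∈ Czpol := by
  induction hs using Algebra.adjoin_induction with
  | mem x hx =>
    rw [Set.mem_singleton_iff.1 hx]
    have : shiftSeq k tau = tau + algebraMap ℂ (ℤ → ℂ) k := by
      funext n
      change ((n + k : ℤ) : ℂ) = (n : ℂ) + (k : ℂ)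
      push_cast; rfl
    rw [this]
    exact add_mem (Algebra.subset_adjoin rfl) (Subalgebra.algebraMap_mem _ _)
  | algebraMap r => rw [AlgHom.commutes]; exact Subalgebra.algebraMap_mem _ _
  | add x y _ _ hx hy => rw [map_add]; exact add_mem hx hy
  | mul x y _ _ hx hy => rw [map_mul]; exact mul_mem hx hy

/-- The action of `T ^ k` on polynomial sequences. -/
def shiftPol (k : ℤ) : Czpol →ₐ[ℂ] Czpol :=
  ((shiftSeq k).comp Czpol.val).codRestrict Czpol fun s => shiftSeq_mem k s.2

/-- `τ` as an element of the algebra of polynomial sequences. -/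
def tauPol : Czpol := ⟨tau, Algebra.subset_adjoin rfl⟩

/-- The multiplicative set generated by the translates `T ^ k τ`. -/
def Mset : Submonoid Czpol := Submonoid.closure (Set.range fun k : ℤ => shiftPol k tauPol)

/-- The localization `K = M⁻¹ ℂ_ℤ^pol`. -/
def K : Type := Localization Mset

instance : CommRing K := inferInstanceAs (CommRing (Localization Mset))
instance : Algebra ℂ K := inferInstanceAs (Algebra ℂ (Localization Mset))
instance : Algebra Czpol K := inferInstanceAs (Algebra Czpol (Localization Mset))
instance : IsScalarTower ℂ Czpol K :=
  inferInstanceAs (IsScalarTower ℂ Czpol (Localization Mset))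
instance : IsLocalization Mset K := inferInstanceAs (IsLocalization Mset (Localization Mset))

theorem shiftPol_shiftPol (k l : ℤ) (s : Czpol) :
    shiftPol k (shiftPol l s) = shiftPol (k + l) s := by
  apply Subtype.ext
  funext n
  change s.1 (n + k + l) = s.1 (n + (k + l))
  rw [add_assoc]

theorem shiftPol_zero (s : Czpol) : shiftPol 0 s = s := by
  apply Subtype.ext
  funext n
  change s.1 (n + 0) = s.1 n
  rw [add_zero]

theorem shiftPol_mem (k : ℤ) {m : Czpol} (hm : m ∈ Mset) : shiftPol k m ∈ Mset := by
  induction hm using Submonoid.closure_induction with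
  | mem x hx =>
    obtain ⟨l, rfl⟩ := hx
    exact Submonoid.subset_closure ⟨k + l, (shiftPol_shiftPol k l tauPol).symm⟩
  | one => rw [map_one]; exact one_mem _
  | mul x y _ _ hx hy => rw [map_mul]; exact mul_mem hx hy

/-- The action of `T ^ k` on `K`, `T ^ k (f / g) = (T ^ k f) / (T ^ k g)`. -/
def shiftK (k : ℤ) : K →ₐ[ℂ] K :=
  IsLocalization.liftAlgHom (M := Mset) (S := K)
    (f := (IsScalarTower.toAlgHom ℂ Czpol K).comp (shiftPol k))
    fun y => IsLocalization.map_units K (⟨shiftPol k y, shiftPol_mem k y.2⟩ : Mset)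

theorem shiftK_algebraMap (k : ℤ) (s : Czpol) :
    shiftK k (algebraMap Czpol K s) = algebraMap Czpol K (shiftPol k s) :=
  IsLocalization.lift_eq _ s

theorem algHomK_ext {B : Type*} [CommRing B] [Algebra ℂ B] {f g : K →ₐ[ℂ] B}
    (h : ∀ s : Czpol, f (algebraMap Czpol K s) = g (algebraMap Czpol K s)) : f = g := by
  have : f.toRingHom = g.toRingHom :=
    IsLocalization.ringHom_ext Mset (RingHom.ext h)
  ext x
  exact RingHom.congr_fun this x

/-- The translations of `K` as a representation of `ℤ`. -/
def shiftRep : Multiplicative ℤ →* Module.End ℂ K where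
  toFun k := (shiftK k.toAdd).toLinearMap
  map_one' := by
    have : shiftK 0 = AlgHom.id ℂ K := algHomK_ext fun s => by
      rw [shiftK_algebraMap, shiftPol_zero]; rfl
    rw [toAdd_one, this]; rfl
  map_mul' k l := by
    have : shiftK (k.toAdd + l.toAdd) = (shiftK k.toAdd).comp (shiftK l.toAdd) :=
      algHomK_ext fun s => by
        rw [AlgHom.comp_apply]
        simp only [shiftK_algebraMap, shiftPol_shiftPol]
    rw [toAdd_mul, this]; rfl

/-- The action of `H_T` on `K`. -/
def actK : HT →ₐ[ℂ] Module.End ℂ K := AddMonoidAlgebra.lift ℂ (Module.End ℂ K) ℤ shiftRep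

instance : Module HT K := Module.compHom K actK.toRingHom

instance : IsScalarTower ℂ HT K := ⟨fun c h x => by
  change actK (c • h) x = c • actK h x
  rw [map_smul]; rfl⟩

theorem Tp_smul (k : ℤ) (x : K) : Tp k • x = shiftK k x := by
  change actK (AddMonoidAlgebra.single k 1) x = shiftK k x
  rw [actK, AddMonoidAlgebra.lift_single, one_smul]; rfl

/-- The element `1 / τ` of `K`. -/
def invTau : K :=
  IsLocalization.mk' K 1
    (⟨tauPol, Submonoid.subset_closure ⟨0, shiftPol_zero tauPol⟩⟩ : Mset)

/-- The element `T ^ (-n) (1 / τ ^ (k+1)) = 1 / (τ - n) ^ (k+1)` of `K`. -/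
def pole (i : ℤ × ℕ) : K := Tp (-i.1) • invTau ^ (i.2 + 1)

/-- The polynomial sequences as a subspace of `K`. -/
def polK : Submodule ℂ K := LinearMap.range (IsScalarTower.toAlgHom ℂ Czpol K).toLinearMap

/-- The singular part of `K`, spanned by the `T ^ n (1 / τ ^ (k+1))`. -/
def KSing : Submodule ℂ K := Submodule.span ℂ (Set.range pole)

/-! ### The decomposition `K = ℂ_ℤ^pol ⊕ K_Sing` (partial fractions) -/

/-- `τ - n` in `K`. -/
def lin (n : ℤ) : K := algebraMap Czpol K (shiftPol (-n) tauPol)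

/-- `1 / (τ - n)` in `K`. -/
def linInv (n : ℤ) : K := shiftK (-n) invTau

theorem shiftPol_tauPol (k : ℤ) : shiftPol k tauPol = tauPol + algebraMap ℂ Czpol k := by
  apply Subtype.ext
  funext n
  change ((n + k : ℤ) : ℂ) = (n : ℂ) + (k : ℂ)
  push_cast; rfl

theorem lin_eq (n : ℤ) : lin n = algebraMap Czpol K tauPol - algebraMap ℂ K n := by
  rw [lin, shiftPol_tauPol, map_add, ← IsScalarTower.algebraMap_apply, Int.cast_neg,
    map_neg (algebraMap ℂ K), sub_eq_add_neg]

theorem linInv_mul_lin (n : ℤ) : linInv n * lin n = 1 := by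
  rw [lin, linInv, ← shiftK_algebraMap, ← map_mul, invTau]
  have := IsLocalization.mk'_spec K (1 : Czpol)
    (⟨tauPol, Submonoid.subset_closure ⟨0, shiftPol_zero tauPol⟩⟩ : Mset)
  rw [this, map_one, map_one]

theorem pole_eq (i : ℤ × ℕ) : pole i = linInv i.1 ^ (i.2 + 1) := by
  rw [pole, Tp_smul, map_pow, linInv]

theorem linInv_mul_linInv (n m : ℤ) :
    (algebraMap ℂ K ((n : ℂ) - m)) * (linInv n * linInv m) = linInv n - linInv m := by
  have h : algebraMap ℂ K ((n : ℂ) - m) = lin m - lin n := by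
    rw [lin_eq, lin_eq, map_sub]; ring
  have h1 := linInv_mul_lin n
  have h2 := linInv_mul_lin m
  rw [h]
  linear_combination (linInv n) * h2 - (linInv m) * h1

theorem linInv_pow_mem (n : ℤ) (k : ℕ) : linInv n ^ (k + 1) ∈ polK ⊔ KSing :=
  Submodule.mem_sup_right (Submodule.subset_span ⟨(n, k), pole_eq (n, k)⟩)

theorem algebraMap_mem_polK (s : Czpol) : algebraMap Czpol K s ∈ polK := ⟨s, rfl⟩

theorem exists_div (n : ℤ) (s : Czpol) : ∃ (q : Czpol) (c : ℂ),
    algebraMap Czpol K s = lin n * algebraMap Czpol K q + algebraMap ℂ K c := by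
  obtain ⟨s, hs⟩ := s
  induction hs using Algebra.adjoin_induction with
  | mem x hx =>
    refine ⟨1, n, ?_⟩
    obtain rfl : x = tau := hx
    rw [lin_eq, map_one, mul_one, sub_add_cancel]; rfl
  | algebraMap r =>
    refine ⟨0, r, ?_⟩
    rw [map_zero, mul_zero, zero_add, IsScalarTower.algebraMap_apply ℂ Czpol K]; rfl
  | add x y hx hy h1 h2 =>
    obtain ⟨q1, c1, h1⟩ := h1
    obtain ⟨q2, c2, h2⟩ := h2
    refine ⟨q1 + q2, c1 + c2, ?_⟩
    have : (⟨x + y, add_mem hx hy⟩ : Czpol) = ⟨x, hx⟩ + ⟨y, hy⟩ := rfl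
    rw [this, map_add, h1, h2, map_add, map_add]; ring
  | mul x y hx hy h1 h2 =>
    obtain ⟨q1, c1, h1⟩ := h1
    obtain ⟨q2, c2, h2⟩ := h2
    refine ⟨shiftPol (-n) tauPol * q1 * q2 + algebraMap ℂ Czpol c1 * q2
      + algebraMap ℂ Czpol c2 * q1, c1 * c2, ?_⟩
    have : (⟨x * y, mul_mem hx hy⟩ : Czpol) = ⟨x, hx⟩ * ⟨y, hy⟩ := rfl
    rw [this, map_mul, h1, h2]
    simp only [map_add, map_mul, ← IsScalarTower.algebraMap_apply]
    rw [← lin]; ring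

theorem linInv_mul_mem (n : ℤ) {w : K} (hw : w ∈ polK ⊔ KSing) :
    linInv n * w ∈ polK ⊔ KSing := by
  have key : ∀ m k, linInv n * linInv m ^ (k + 1) ∈ polK ⊔ KSing := by
    intro m k
    by_cases hnm : n = m
    · subst hnm
      rw [← pow_succ']; exact linInv_pow_mem n (k + 1)
    have hne : ((n : ℂ) - m) ≠ 0 := sub_ne_zero.2 (by exact_mod_cast hnm)
    have step : ∀ k, linInv n * linInv m ^ (k + 1) =
        ((n : ℂ) - m)⁻¹ • (linInv n * linInv m ^ k - linInv m ^ (k + 1)) := by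
      intro k
      rw [eq_inv_smul_iff₀ hne, Algebra.smul_def]
      linear_combination (linInv m ^ k) * linInv_mul_linInv n m
    induction k with
    | zero =>
      rw [step]
      refine Submodule.smul_mem _ _ (Submodule.sub_mem _ ?_ (linInv_pow_mem m 0))
      have := linInv_pow_mem n 0
      simpa using this
    | succ k ih =>
      rw [step]
      exact Submodule.smul_mem _ _ (Submodule.sub_mem _ ih (linInv_pow_mem m _))
  obtain ⟨a, ha, b, hb, rfl⟩ := Submodule.mem_sup.1 hw
  rw [mul_add]
  refine add_mem ?_ ?_
  · obtain ⟨s, rfl⟩ := ha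
    obtain ⟨q, c, hq⟩ := exists_div n s
    change linInv n * algebraMap Czpol K s ∈ _
    have : linInv n * algebraMap Czpol K s =
        algebraMap Czpol K q + c • linInv n ^ (0 + 1) := by
      rw [hq, Algebra.smul_def]
      linear_combination (algebraMap Czpol K q) * linInv_mul_lin n
    rw [this]
    exact add_mem (Submodule.mem_sup_left (algebraMap_mem_polK q))
      (Submodule.smul_mem _ _ (linInv_pow_mem n 0))
  · clear hw
    induction hb using Submodule.span_induction with
    | mem x hx =>
      obtain ⟨i, rfl⟩ := hx
      rw [pole_eq]; exact key _ _
    | zero => rw [mul_zero]; exact zero_mem _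
    | add x y hx hy h1 h2 => rw [mul_add]; exact add_mem h1 h2
    | smul c x hx h => rw [mul_smul_comm]; exact Submodule.smul_mem _ _ h

theorem polK_sup_KSing : polK ⊔ KSing = ⊤ := by
  have key : ∀ g ∈ Mset, ∀ y : K, algebraMap Czpol K g * y ∈ polK ⊔ KSing →
      y ∈ polK ⊔ KSing := by
    intro g hg
    induction hg using Submonoid.closure_induction with
    | mem x hx =>
      obtain ⟨k, rfl⟩ := hx
      intro y hy
      have h := linInv_mul_mem (-k) hy
      have h1 := linInv_mul_lin (-k)
      rw [lin, neg_neg] at h1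
      rwa [← mul_assoc, h1, one_mul] at h
    | one => intro y hy; simpa using hy
    | mul a b _ _ ha hb =>
      intro y hy
      rw [map_mul, mul_assoc] at hy
      exact hb y (ha _ hy)
  rw [eq_top_iff]
  rintro y -
  obtain ⟨⟨f, g⟩, hfg⟩ := IsLocalization.surj Mset y
  refine key g g.2 y (Submodule.mem_sup_left ?_)
  rw [mul_comm, hfg]
  exact algebraMap_mem_polK f

/-- Polynomial sequences are polynomials in `τ`. -/
def polEquiv : Polynomial ℂ ≃ₐ[ℂ] Czpol :=
  AlgEquiv.ofBijective (Polynomial.aeval tauPol) (by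
    have hval : ∀ (p : Polynomial ℂ) (n : ℤ), (Polynomial.aeval tauPol p).1 n = p.eval (n : ℂ) := by
      intro p n
      have h : ((Pi.evalAlgHom ℂ (fun _ : ℤ => ℂ) n).comp Czpol.val).comp
          (Polynomial.aeval tauPol) = Polynomial.aeval (n : ℂ) := by
        apply Polynomial.algHom_ext; simp [tauPol, tau]
      have := DFunLike.congr_fun h p
      rw [Polynomial.coe_aeval_eq_eval] at this
      exact this
    constructor
    · intro p q hpq
      apply Polynomial.eq_of_infinite_eval_eq
      refine Set.Infinite.mono (s := Set.range fun n : ℤ => (n : ℂ)) ?_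
        (Set.infinite_range_of_injective Int.cast_injective)
      rintro _ ⟨n, rfl⟩
      change p.eval (n : ℂ) = q.eval (n : ℂ)
      rw [← hval, ← hval, hpq]
    · rintro ⟨s, hs⟩
      rw [Czpol, Algebra.adjoin_singleton_eq_range_aeval] at hs
      obtain ⟨p, hp⟩ := hs
      refine ⟨p, Subtype.ext ?_⟩
      have : (Czpol.val).comp (Polynomial.aeval tauPol) = Polynomial.aeval tau := by
        apply Polynomial.algHom_ext; simp [tauPol]
      exact (DFunLike.congr_fun this p).trans hp)

theorem polEquiv_symm_tauPol : polEquiv.symm tauPol = Polynomial.X := by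
  rw [AlgEquiv.symm_apply_eq]
  exact (Polynomial.aeval_X tauPol).symm

/-- Taylor expansion of a polynomial sequence at the integer `n`. -/
def taylorPol (n : ℤ) : Czpol →ₐ[ℂ] PowerSeries ℂ :=
  (Polynomial.aeval (PowerSeries.C (n : ℂ) + PowerSeries.X)).comp polEquiv.symm.toAlgHom

theorem taylorPol_shift (n m : ℤ) :
    taylorPol n (shiftPol (-m) tauPol) = PowerSeries.C ((n : ℂ) - m) + PowerSeries.X := by
  have : taylorPol n tauPol = PowerSeries.C (n : ℂ) + PowerSeries.X := by
    change Polynomial.aeval _ (polEquiv.symm tauPol) = _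
    rw [polEquiv_symm_tauPol, Polynomial.aeval_X]
  rw [shiftPol_tauPol, map_add, this, AlgHom.commutes, PowerSeries.algebraMap_apply]
  rw [Int.cast_neg, Algebra.algebraMap_self, RingHom.id_apply, map_neg (PowerSeries.C (R := ℂ)),
    map_sub (PowerSeries.C (R := ℂ))]
  ring

theorem taylorPol_ne_zero (n m : ℤ) : taylorPol n (shiftPol (-m) tauPol) ≠ 0 := by
  rw [taylorPol_shift]
  intro h
  have := congrArg (PowerSeries.coeff 1) h
  rw [map_add, PowerSeries.coeff_C, PowerSeries.coeff_one_X, map_zero, if_neg one_ne_zero,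
    zero_add] at this
  exact one_ne_zero this

/-- Taylor expansion with values in Laurent series. -/
def laurentPol (n : ℤ) : Czpol →+* LaurentSeries ℂ :=
  (HahnSeries.ofPowerSeries ℤ ℂ).comp (taylorPol n).toRingHom

theorem laurentPol_apply (n : ℤ) (s : Czpol) :
    laurentPol n s = HahnSeries.ofPowerSeries ℤ ℂ (taylorPol n s) := rfl

/-- Laurent expansion of an element of `K` at the integer `n`. -/
def laurentK (n : ℤ) : K →+* LaurentSeries ℂ :=
  IsLocalization.lift (M := Mset) (S := K) (g := laurentPol n) fun y => by
    obtain ⟨y, hy⟩ := y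
    induction hy using Submonoid.closure_induction with
    | mem x hx =>
      obtain ⟨k, rfl⟩ := hx
      refine IsUnit.mk0 _ ?_
      change laurentPol n (shiftPol k tauPol) ≠ 0
      rw [laurentPol_apply, Ne, map_eq_zero_iff _ HahnSeries.ofPowerSeries_injective,
        ← neg_neg k]
      exact taylorPol_ne_zero n (-k)
    | one => exact (map_one (laurentPol n)).symm ▸ isUnit_one
    | mul a b _ _ ha hb => exact (map_mul (laurentPol n) a b).symm ▸ ha.mul hb

theorem laurentK_algebraMap (n : ℤ) (s : Czpol) :
    laurentK n (algebraMap Czpol K s) = HahnSeries.ofPowerSeries ℤ ℂ (taylorPol n s) :=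
  IsLocalization.lift_eq _ s

/-- The coefficient of `(τ - n) ^ (-k-1)` in the Laurent expansion at `n`. -/
def polarCoeff (i : ℤ × ℕ) : K →ₗ[ℂ] ℂ where
  toFun x := (laurentK i.1 x).coeff (-(i.2 + 1 : ℤ))
  map_add' x y := by rw [map_add]; rfl
  map_smul' c x := by
    have : laurentK i.1 (algebraMap ℂ K c) = HahnSeries.C c := by
      rw [IsScalarTower.algebraMap_apply ℂ Czpol K, laurentK_algebraMap, AlgHom.commutes,
        PowerSeries.algebraMap_apply, Algebra.algebraMap_self, RingHom.id_apply,
        HahnSeries.ofPowerSeries_C]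
    rw [Algebra.smul_def, map_mul, this, HahnSeries.C_mul_eq_smul]; rfl

theorem coeff_neg_ofPowerSeries (f : PowerSeries ℂ) (k : ℕ) :
    (HahnSeries.ofPowerSeries ℤ ℂ f).coeff (-(k + 1 : ℤ)) = 0 := by
  have := PowerSeries.coeff_coe f (-(k + 1 : ℤ))
  rw [if_pos (by lia)] at this
  exact this

theorem polarCoeff_pol (i : ℤ × ℕ) (s : Czpol) : polarCoeff i (algebraMap Czpol K s) = 0 := by
  change (laurentK i.1 (algebraMap Czpol K s)).coeff _ = 0
  rw [laurentK_algebraMap, coeff_neg_ofPowerSeries]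

theorem polarCoeff_pole (i j : ℤ × ℕ) : polarCoeff i (pole j) = if i = j then 1 else 0 := by
  obtain ⟨n, k⟩ := i
  obtain ⟨m, l⟩ := j
  change (laurentK n (pole (m, l))).coeff (-(k + 1 : ℤ)) = _
  rw [pole_eq, map_pow]
  have h : laurentK n (linInv m) *
      HahnSeries.ofPowerSeries ℤ ℂ (PowerSeries.C ((n : ℂ) - m) + PowerSeries.X) = 1 := by
    rw [← taylorPol_shift, ← laurentK_algebraMap, ← map_mul, ← lin, linInv_mul_lin, map_one]
  by_cases hnm : n = m
  · subst hnm
    rw [sub_self, map_zero, zero_add, HahnSeries.ofPowerSeries_X] at h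
    have h2 : laurentK n (linInv n) = HahnSeries.single (-1) 1 := by
      have h3 : (HahnSeries.single (1 : ℤ) (1 : ℂ)) * HahnSeries.single (-1) 1 = 1 := by
        rw [HahnSeries.single_mul_single]; simp
      calc laurentK n (linInv n)
          = laurentK n (linInv n) * (HahnSeries.single 1 1 * HahnSeries.single (-1) 1) := by
            rw [h3, mul_one]
        _ = _ := by rw [← mul_assoc, h, one_mul]
    rw [h2, HahnSeries.single_pow, one_pow, HahnSeries.coeff_single]
    simp only [Prod.mk.injEq, true_and]
    congr 1
    apply propext
    simp only [nsmul_eq_mul]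
    push_cast
    constructor <;> intro h <;> lia
  · have hne : ((n : ℂ) - m) ≠ 0 := sub_ne_zero.2 (by exact_mod_cast hnm)
    set P : PowerSeries ℂ := PowerSeries.C ((n : ℂ) - m) + PowerSeries.X with hP
    have hP0 : PowerSeries.constantCoeff P ≠ 0 := by simpa [hP] using hne
    have h2 : laurentK n (linInv m) = HahnSeries.ofPowerSeries ℤ ℂ P⁻¹ := by
      calc laurentK n (linInv m)
          = laurentK n (linInv m) * HahnSeries.ofPowerSeries ℤ ℂ (P * P⁻¹) := by
            rw [PowerSeries.mul_inv_cancel _ hP0, map_one, mul_one]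
        _ = _ := by rw [map_mul, ← mul_assoc, h, one_mul]
    rw [h2, ← map_pow, coeff_neg_ofPowerSeries, if_neg]
    intro h; exact hnm (congrArg Prod.fst h)

theorem pole_linearIndependent : LinearIndependent ℂ pole :=
  LinearIndependent.of_pairwise_dual_eq_zero_one pole polarCoeff
    (fun i j h => (polarCoeff_pole i j).trans (if_neg h)) (fun i => (polarCoeff_pole i i).trans (if_pos rfl))

theorem isCompl_polK_KSing : IsCompl polK KSing := by
  refine ⟨?_, codisjoint_iff.2 polK_sup_KSing⟩
  rw [Submodule.disjoint_def]
  rintro _ ⟨s, rfl⟩ hx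
  obtain ⟨c, hc⟩ := (Finsupp.mem_span_range_iff_exists_finsupp).1 hx
  have : c = 0 := by
    ext i
    have h := congrArg (polarCoeff i) hc
    change _ = polarCoeff i (algebraMap Czpol K s) at h
    rw [polarCoeff_pol, Finsupp.sum, map_sum] at h
    simpa [polarCoeff_pole] using h
  rw [← hc, this, Finsupp.sum_zero_index]

/-- The quotient `K / ℂ_ℤ^pol`. -/
abbrev KBar : Type := K ⧸ polK

/-- The projection `Sing : K → K_Sing ⊂ K` along `ℂ_ℤ^pol`, viewed as a map on `K / ℂ_ℤ^pol`. -/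
def sing : KBar →ₗ[ℂ] K :=
  KSing.subtype ∘ₗ (Submodule.quotientEquivOfIsCompl polK KSing isCompl_polK_KSing).toLinearMap

/-- The basis of `K_Sing` formed by the `1 / (τ - n) ^ (l+1) = S (T ^ n ∂ ^ l / l!) (1 / τ)`. -/
def singBasis : Module.Basis (ℤ × ℕ) ℂ KSing := Module.Basis.span pole_linearIndependent

/-- The basis of `K / ℂ_ℤ^pol` formed by the classes of
`1 / (τ - n) ^ (l+1) = S (T ^ n ∂ ^ l / l!) (1 / τ)`. -/
def polarBasis : Module.Basis (ℤ × ℕ) ℂ KBar :=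
  singBasis.map (Submodule.quotientEquivOfIsCompl polK KSing isCompl_polK_KSing).symm

theorem polarBasis_apply (i : ℤ × ℕ) : polarBasis i = polK.mkQ (pole i) := by
  have h : singBasis i = (⟨pole i, Submodule.subset_span ⟨i, rfl⟩⟩ : KSing) :=
    Module.Basis.span_apply _ _
  rw [polarBasis, Module.Basis.map_apply, h, LinearEquiv.symm_apply_eq]
  exact (Submodule.quotientEquivOfIsCompl_apply_mk_right _ _).symm

theorem sing_polarBasis (i : ℤ × ℕ) : sing (polarBasis i) = pole i := by
  have h : singBasis i = (⟨pole i, Submodule.subset_span ⟨i, rfl⟩⟩ : KSing) :=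
    Module.Basis.span_apply _ _
  rw [polarBasis, Module.Basis.map_apply, h, sing, LinearMap.comp_apply, LinearEquiv.coe_coe,
    LinearEquiv.apply_symm_apply]
  rfl

theorem antip_smul_invTau (k : ℤ) : (antip (Tp k) • invTau : K) = pole (k, 0) := by
  rw [antip, Tp, LaurentPolynomial.antipode_T, pole, zero_add, pow_one]

/-- The class of `S(T ^ k) (1 / τ)` in `K / ℂ_ℤ^pol`. -/
theorem mkQ_antip_invTau (k : ℤ) : polK.mkQ (antip (Tp k) • invTau) = polarBasis (k, 0) := by
  rw [antip_smul_invTau, polarBasis_apply]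

/-! ### The action of sequences on `K / ℂ_ℤ^pol` -/

/-- The action of `H_T^* = ℂ^ℤ` on `K / ℂ_ℤ^pol`. It is transported from the action
`s . h = ∑ s(h') h''` on `H_T[∂]` (so `s . T ^ n ∂ ^ l = s n T ^ n ∂ ^ l`) by means of
`P ↦ S(P) (1 / τ)`. -/
def seqAct (s : ℤ → ℂ) : KBar →ₗ[ℂ] KBar :=
  polarBasis.constr ℂ fun i => s i.1 • polarBasis i

/-- The extension of `seqAct` to `K`-valued functionals `B ∈ K ⊗̂ H_T^* = Hom(H_T, K)`: for
`B = b ⊗ s` it is `κ ↦ b ⊗ (s . κ)`. -/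
def holAct (B : HT →ₗ[ℂ] K) : KBar →ₗ[ℂ] K ⊗[ℂ] KBar :=
  polarBasis.constr ℂ fun i => B (Tp i.1) ⊗ₜ[ℂ] polarBasis i

/-- The holomorphic vertex operator of `K`: `Y_Hol(p) q = ∑ Δ[n](p) q ⊗ Δ*[n]`, that is, the
`K`-valued functional `h ↦ h(p) q` on `H_T`. -/
def yHol (p q : K) : HT →ₗ[ℂ] K :=
  LinearMap.mulRight ℂ q ∘ₗ (LinearMap.toSpanSingleton HT K p).restrictScalars ℂ

/-! ### `H_T`-conformal algebras -/

section Conformal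

/-- The structure of an `H_T`-conformal algebra on an `H_T`-module `C`; `prod n f g` is the
product `f_n g`. -/
@[ext]
structure ConformalAlgebra (C : Type*) [AddCommGroup C] [Module ℂ C] [Module HT C] where
  /-- The products `f_n g`, `n ∈ ℤ`. -/
  prod : ℤ → C →ₗ[ℂ] C →ₗ[ℂ] C
  finite : ∀ f g : C, {n : ℤ | prod n f g ≠ 0}.Finite
  covariance : ∀ (f g : C) (n p : ℤ), prod n (Tp p • f) g = prod (n + p) f g
  skew : ∀ (f g : C) (n : ℤ), prod n f g = -(Tp n • prod (-n) g f)
  commutator : ∀ (f g k : C) (m n : ℤ),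
    prod m f (prod n g k) - prod n g (prod m f k) = prod n (prod (m - n) f g) k

namespace ConformalAlgebra

variable {C : Type*} [AddCommGroup C] [Module ℂ C] [Module HT C]

/-- The product `f_{s} g = ∑ s n • f_n g` labelled by `s ∈ H_T^* = ℂ^ℤ` (a finite sum). -/
def dualProd (A : ConformalAlgebra C) (s : ℤ → ℂ) (f g : C) : C :=
  ∑ᶠ n : ℤ, s n • A.prod n f g

/-- The product `f_⟨n⟩ g`, the one labelled by `Δ*[n]`; thus
`∑ f_n g T ^ n = ∑ f_⟨n⟩ g Δ[n]`. -/
def angle (A : ConformalAlgebra C) (n : ℤ) (f g : C) : C := A.dualProd (deltaDual n) f g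

/-- The singular vertex operator
`Y_Sing(f, τ) g = ∑ f_n g S(T ^ n) (1 / τ) = ∑ f_⟨n⟩ g S(Δ[n]) (1 / τ)`. -/
def ySing (A : ConformalAlgebra C) (f g : C) : C ⊗[ℂ] K :=
  ∑ᶠ n : ℤ, A.prod n f g ⊗ₜ[ℂ] (antip (Tp n) • invTau)

end ConformalAlgebra

end Conformal

/-! ### Affinization -/

/-- The affinization `LM = M ⊗ K`. -/
def Affinization (M : Type*) [AddCommGroup M] [Module ℂ M] : Type _ := M ⊗[ℂ] K

section Affinization

variable {M : Type*} [AddCommGroup M] [Module ℂ M]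

instance : AddCommGroup (Affinization M) := inferInstanceAs (AddCommGroup (M ⊗[ℂ] K))
instance : Module ℂ (Affinization M) := inferInstanceAs (Module ℂ (M ⊗[ℂ] K))

/-- The identification `M ⊗ K = LM`. -/
def affEquiv : (M ⊗[ℂ] K) ≃ₗ[ℂ] Affinization M := LinearEquiv.refl ℂ (M ⊗[ℂ] K)

/-- The element `f ⊗ p` of the affinization. -/
def aff (f : M) (p : K) : Affinization M := affEquiv (f ⊗ₜ[ℂ] p)

variable [Module HT M] [IsScalarTower ℂ HT M]

/-- The action of `H_T` on the affinization, through the coproduct. -/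
def actAff : HT →ₐ[ℂ] Module.End ℂ (M ⊗[ℂ] K) :=
  (Module.endTensorEndAlgHom (R := ℂ) (S := ℂ) (A := ℂ) (M := M) (N := K)).comp
    ((Algebra.TensorProduct.map (Algebra.lsmul ℂ ℂ M : HT →ₐ[ℂ] Module.End ℂ M)
      (Algebra.lsmul ℂ ℂ K : HT →ₐ[ℂ] Module.End ℂ K)).comp (Bialgebra.comulAlgHom ℂ HT))

instance : Module HT (Affinization M) :=
  Module.compHom (M ⊗[ℂ] K) (actAff (M := M)).toRingHom

instance : IsScalarTower ℂ HT (Affinization M) := ⟨fun c h x => by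
  change actAff (M := M) (c • h) x = c • actAff (M := M) h x
  rw [map_smul]; rfl⟩

theorem Tp_smul_aff (n : ℤ) (f : M) (p : K) : Tp n • aff f p = aff (Tp n • f) (Tp n • p) := by
  change actAff (M := M) (Tp n) (f ⊗ₜ[ℂ] p) = _
  rw [actAff, AlgHom.comp_apply, AlgHom.comp_apply, Bialgebra.comulAlgHom_apply,
    LaurentPolynomial.comul_T]
  rfl

/-- The dotted tensor product of `a ∈ M ⊗ K` (a distribution with singular values) and
`B ∈ K ⊗̂ H_T^*`: `(f ⊗ κ) ⊗̇ (p ⊗ s) = (f ⊗ p) ⊗ (s . κ)`, with values in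
`LM ⊗ (K / ℂ_ℤ^pol)`. -/
def dotTensor (a : M ⊗[ℂ] K) (B : HT →ₗ[ℂ] K) : Affinization M ⊗[ℂ] KBar :=
  (affEquiv (M := M)).toLinearMap.rTensor KBar
    ((TensorProduct.assoc ℂ M K KBar).symm ((holAct B ∘ₗ polK.mkQ).lTensor M a))

/-- The operator
`Y^{LC}_Sing(f ⊗ p, τ)(g ⊗ q) = Sing (Y_Sing(f, τ) g ⊗̇ Y_Hol(p, τ) q)`. -/
def ConformalAlgebra.yAff (A : ConformalAlgebra M) (f : M) (p : K) (g : M) (q : K) :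
    Affinization M ⊗[ℂ] K :=
  sing.lTensor (Affinization M) (dotTensor (A.ySing f g) (yHol p q))

/-- The module of coinvariants `M / 𝔪M`. -/
abbrev Coinv (M : Type*) [AddCommGroup M] [Module HT M] : Type _ :=
  M ⧸ (augIdeal • (⊤ : Submodule HT M))

/-- The canonical projection `Tr : M → M / 𝔪M`. -/
def Tr : M →ₗ[ℂ] Coinv M :=
  ((augIdeal • (⊤ : Submodule HT M)).mkQ).restrictScalars ℂ

/-- The element `f_{p} = Tr (f ⊗ p)` of `𝓛M = LM / 𝔪LM`. -/
def trAff (f : M) (p : K) : Coinv (Affinization M) := Tr (aff f p)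

end Affinization

/-- A bilinear map is a Lie bracket if it is alternating and satisfies the Jacobi identity. -/
structure IsLieBracket {L : Type*} [AddCommGroup L] [Module ℂ L] (br : L →ₗ[ℂ] L →ₗ[ℂ] L) :
    Prop where
  alternating : ∀ x : L, br x x = 0
  jacobi : ∀ x y z : L, br x (br y z) + br y (br z x) + br z (br x y) = 0

/-! ### Expansions in the difference basis -/

theorem deltaDual_eq_zero (n k : ℤ) (h : |k| < |n|) : deltaDual n k = 0 := by
  cases n with
  | ofNat m =>
    rw [deltaDual]
    split_ifs with hc
    · rw [Finset.prod_eq_zero_iff]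
      have hk : 0 ≤ k := by
        rcases hc with rfl | hk
        · simp at h; exact absurd h (not_lt.2 (abs_nonneg k))
        · exact hk
      refine ⟨k.toNat, ?_, ?_⟩
      · rw [abs_of_nonneg hk, Int.ofNat_eq_natCast, Nat.abs_cast] at h
        exact Finset.mem_range.2 (by lia)
      · have : ((k.toNat : ℤ) : ℂ) = k := by rw [Int.toNat_of_nonneg hk]
        rw [Int.cast_natCast] at this
        rw [this, sub_self]
    · rfl
  | negSucc m =>
    rw [deltaDual]
    split_ifs with hk
    · rw [Finset.prod_eq_zero_iff]
      refine ⟨(-k).toNat, ?_, ?_⟩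
      · rw [abs_of_nonpos hk, Int.negSucc_eq, abs_neg, abs_of_nonneg (by lia)] at h
        exact Finset.mem_range.2 (by lia)
      · have : (((-k).toNat : ℤ) : ℂ) = ((-k : ℤ) : ℂ) := by
          rw [Int.toNat_of_nonneg (by lia)]
        rw [Int.cast_natCast] at this
        rw [this]; push_cast; ring
    · rfl

theorem deltaDual_natCast_natCast (m k : ℕ) :
    deltaDual (m : ℤ) (k : ℤ) = (m.factorial : ℂ) * (k.choose m : ℂ) := by
  change (if m = 0 ∨ (0 : ℤ) ≤ k then ∏ j ∈ Finset.range m, (((k : ℤ) : ℂ) - j) else 0) = _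
  rw [if_pos (Or.inr (Int.natCast_nonneg k)), Int.cast_natCast, ← Nat.cast_mul,
    ← Nat.descFactorial_eq_factorial_mul_choose, ← descPochhammer_eval_eq_descFactorial,
    descPochhammer_eval_eq_prod_range]

theorem deltaDual_neg_neg (m k : ℕ) :
    deltaDual (-(m : ℤ)) (-(k : ℤ)) = (m.factorial : ℂ) * ((-1) ^ m * (k.choose m : ℂ)) := by
  have hprod : ∏ j ∈ Finset.range m, (((-(k : ℤ) : ℤ) : ℂ) + j) =
      (m.factorial : ℂ) * ((-1) ^ m * (k.choose m : ℂ)) := by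
    have h := deltaDual_natCast_natCast m k
    change (if m = 0 ∨ (0 : ℤ) ≤ k then ∏ j ∈ Finset.range m, (((k : ℤ) : ℂ) - j) else 0) = _ at h
    rw [if_pos (Or.inr (Int.natCast_nonneg k))] at h
    rw [mul_left_comm, ← h, ← Finset.card_range m, ← Finset.prod_const, Finset.card_range,
      ← Finset.prod_mul_distrib]
    refine Finset.prod_congr rfl fun j _ => ?_
    push_cast; ring
  cases m with
  | zero => simp [deltaDual]
  | succ m =>
    rw [← hprod]
    change (if -(k : ℤ) ≤ 0 then _ else _) = _
    rw [if_pos (by lia)]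

theorem delta_natCast (m : ℕ) : delta (m : ℤ) = (m.factorial : ℂ)⁻¹ • (Tp 1 - 1) ^ m := rfl

theorem delta_neg (m : ℕ) : delta (-(m : ℤ)) = (m.factorial : ℂ)⁻¹ • (1 - Tp (-1)) ^ m := by
  cases m with
  | zero => simp [delta]
  | succ m => rfl

/-- The sequences `Δ*[n]` are dual to the operators `Δ[n]`: `T ^ k = ∑ ⟨T ^ k, Δ*[n]⟩ Δ[n]`. -/
theorem Tp_eq_sum (k : ℤ) (N : ℕ) (hN : |k| ≤ N) :
    Tp k = ∑ n ∈ Finset.Icc (-(N : ℤ)) N, deltaDual n k • delta n := by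
  have hf : ∀ m : ℕ, (m.factorial : ℂ) ≠ 0 := fun m => Nat.cast_ne_zero.2 m.factorial_ne_zero
  obtain ⟨l, rfl | rfl⟩ := k.eq_nat_or_neg
  · have hl : l ≤ N := by rw [Nat.abs_cast] at hN; exact_mod_cast hN
    have hsub : (Finset.range (l + 1)).map Nat.castEmbedding ⊆ Finset.Icc (-(N : ℤ)) N := by
      intro x hx
      obtain ⟨a, ha, rfl⟩ := Finset.mem_map.1 hx
      have := Finset.mem_range.1 ha
      simp only [Nat.castEmbedding_apply, Finset.mem_Icc]
      lia
    rw [← Finset.sum_subset hsub, Finset.sum_map]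
    · calc Tp (l : ℤ) = (Tp 1 - 1 + 1) ^ l := by
            rw [sub_add_cancel, LaurentPolynomial.T_pow, mul_one]
        _ = _ := by
            rw [add_pow]
            refine Finset.sum_congr rfl fun m _ => ?_
            rw [Nat.castEmbedding_apply, deltaDual_natCast_natCast, delta_natCast, smul_smul,
              mul_comm (m.factorial : ℂ), mul_inv_cancel_right₀ (hf m), Algebra.smul_def,
              map_natCast]
            ring
    · intro n hn hn'
      have : deltaDual n l = 0 := by
        cases n with
        | ofNat m =>
          apply deltaDual_eq_zero
          rw [Int.ofNat_eq_natCast, Nat.abs_cast, Nat.abs_cast]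
          by_contra hc
          exact hn' (Finset.mem_map.2 ⟨m, Finset.mem_range.2 (by lia), rfl⟩)
        | negSucc m =>
          rw [deltaDual]
          split_ifs with h0
          · obtain rfl : l = 0 := by lia
            exact Finset.prod_eq_zero (Finset.mem_range.2 (Nat.succ_pos m)) (by simp)
          · rfl
      rw [this, zero_smul]
  · have hl : l ≤ N := by rw [abs_neg, Nat.abs_cast] at hN; exact_mod_cast hN
    have hsub : (Finset.range (l + 1)).image (fun m : ℕ => -(m : ℤ)) ⊆
        Finset.Icc (-(N : ℤ)) N := by
      intro x hx
      obtain ⟨a, ha, rfl⟩ := Finset.mem_image.1 hx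
      have := Finset.mem_range.1 ha
      simp only [Finset.mem_Icc]
      lia
    rw [← Finset.sum_subset hsub, Finset.sum_image (fun a _ b _ h => by simpa using h)]
    · calc Tp (-(l : ℤ)) = (-(1 - Tp (-1)) + 1) ^ l := by
            rw [neg_sub, sub_add_cancel, LaurentPolynomial.T_pow, mul_neg, mul_one]
        _ = _ := by
            rw [add_pow]
            refine Finset.sum_congr rfl fun m _ => ?_
            rw [deltaDual_neg_neg, delta_neg, smul_smul, mul_comm (m.factorial : ℂ),
              mul_inv_cancel_right₀ (hf m), Algebra.smul_def, map_mul, map_pow,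
              map_neg (algebraMap ℂ HT), map_one, map_natCast, neg_pow (1 - Tp (-1))]
            ring
    · intro n hn hn'
      have : deltaDual n (-(l : ℤ)) = 0 := by
        by_cases hn0 : n ≤ 0
        · apply deltaDual_eq_zero
          rw [abs_neg, Nat.abs_cast, abs_of_nonpos hn0]
          by_contra hc
          exact hn' (Finset.mem_image.2 ⟨(-n).toNat, Finset.mem_range.2 (by lia), by lia⟩)
        · obtain ⟨m, rfl⟩ := Int.eq_ofNat_of_zero_le (le_of_not_ge hn0)
          by_cases hl0 : l = 0
          · subst hl0
            apply deltaDual_eq_zero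
            simp at hn0 ⊢
            lia
          · change (if m = 0 ∨ (0 : ℤ) ≤ -(l : ℤ) then _ else _) = _
            rw [if_neg]
            push Not
            constructor <;> lia
      rw [this, zero_smul]

section Expansions

variable {C : Type*} [AddCommGroup C] [Module ℂ C] [Module HT C]

theorem ConformalAlgebra.exists_bound (A : ConformalAlgebra C) (f g : C) :
    ∃ N : ℕ, ∀ k : ℤ, A.prod k f g ≠ 0 → k ∈ Finset.Icc (-(N : ℤ)) N := by
  refine ⟨(A.finite f g).toFinset.sup Int.natAbs, fun k hk => ?_⟩
  have := Finset.le_sup (f := Int.natAbs) ((A.finite f g).mem_toFinset.2 hk)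
  rw [Finset.mem_Icc]
  lia

theorem ConformalAlgebra.angle_eq_sum (A : ConformalAlgebra C) (f g : C) (N : ℕ)
    (hN : ∀ k : ℤ, A.prod k f g ≠ 0 → k ∈ Finset.Icc (-(N : ℤ)) N) (n : ℤ) :
    A.angle n f g = ∑ k ∈ Finset.Icc (-(N : ℤ)) N, deltaDual n k • A.prod k f g := by
  refine finsum_eq_sum_of_support_subset _ fun k hk => hN k fun h => hk ?_
  change deltaDual n k • A.prod k f g = 0
  rw [h, smul_zero]

theorem ConformalAlgebra.angle_support (A : ConformalAlgebra C) (f g : C) (N : ℕ)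
    (hN : ∀ k : ℤ, A.prod k f g ≠ 0 → k ∈ Finset.Icc (-(N : ℤ)) N) (n : ℤ)
    (hn : A.angle n f g ≠ 0) : n ∈ Finset.Icc (-(N : ℤ)) N := by
  by_contra h
  refine hn ?_
  rw [A.angle_eq_sum f g N hN]
  refine Finset.sum_eq_zero fun k hk => ?_
  rw [deltaDual_eq_zero, zero_smul]
  have hk' : |k| ≤ N := abs_le.2 (Finset.mem_Icc.1 hk)
  by_contra hc
  exact h (Finset.mem_Icc.2 (abs_le.1 ((not_lt.1 hc).trans hk')))

/-- For given `f, g` only finitely many `f_⟨n⟩ g` are nonzero. -/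
theorem ConformalAlgebra.angle_finite (A : ConformalAlgebra C) (f g : C) :
    {n : ℤ | A.angle n f g ≠ 0}.Finite := by
  obtain ⟨N, hN⟩ := A.exists_bound f g
  exact (Finset.finite_toSet (Finset.Icc (-(N : ℤ)) N)).subset
    fun n hn => A.angle_support f g N hN n hn

/-- The singular vertex operator in the difference basis. -/
theorem ConformalAlgebra.ySing_eq_delta (A : ConformalAlgebra C) (f g : C) :
    A.ySing f g = ∑ᶠ n : ℤ, A.angle n f g ⊗ₜ[ℂ] (antip (delta n) • invTau) := by
  obtain ⟨N, hN⟩ := A.exists_bound f g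
  have h1 : A.ySing f g =
      ∑ k ∈ Finset.Icc (-(N : ℤ)) N, A.prod k f g ⊗ₜ[ℂ] (antip (Tp k) • invTau) := by
    refine finsum_eq_sum_of_support_subset _ fun k hk => hN k fun h => hk ?_
    change A.prod k f g ⊗ₜ[ℂ] _ = 0
    rw [h, TensorProduct.zero_tmul]
  have h2 : ∑ᶠ n : ℤ, A.angle n f g ⊗ₜ[ℂ] (antip (delta n) • invTau) =
      ∑ n ∈ Finset.Icc (-(N : ℤ)) N, A.angle n f g ⊗ₜ[ℂ] (antip (delta n) • invTau) := by
    refine finsum_eq_sum_of_support_subset _ fun n hn =>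
      A.angle_support f g N hN n fun h => hn ?_
    change A.angle n f g ⊗ₜ[ℂ] _ = 0
    rw [h, TensorProduct.zero_tmul]
  rw [h1, h2]
  simp only [A.angle_eq_sum f g N hN, TensorProduct.sum_tmul]
  rw [Finset.sum_comm]
  refine Finset.sum_congr rfl fun k hk => ?_
  rw [Tp_eq_sum k N (abs_le.2 (Finset.mem_Icc.1 hk)), map_sum, Finset.sum_smul,
    TensorProduct.tmul_sum]
  refine Finset.sum_congr rfl fun n _ => ?_
  rw [map_smul, smul_assoc, TensorProduct.tmul_smul, TensorProduct.smul_tmul']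

end Expansions

/-- The expansion `B . κ = ∑ B(Δ[n]) ⊗ (Δ*[n] . κ)` in the difference basis, for
`κ = S(T ^ k) (1 / τ)`. -/
theorem holAct_eq_sum (B : HT →ₗ[ℂ] K) (k : ℤ) (N : ℕ) (hN : |k| ≤ N) :
    holAct B (polK.mkQ (antip (Tp k) • invTau)) = ∑ n ∈ Finset.Icc (-(N : ℤ)) N,
      B (delta n) ⊗ₜ[ℂ] seqAct (deltaDual n) (polK.mkQ (antip (Tp k) • invTau)) := by
  rw [mkQ_antip_invTau, holAct, Module.Basis.constr_basis]
  simp only [seqAct, Module.Basis.constr_basis]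
  rw [Tp_eq_sum k N hN, map_sum, TensorProduct.sum_tmul]
  refine Finset.sum_congr rfl fun n _ => ?_
  rw [map_smul, TensorProduct.smul_tmul]

end HTConf

end

open scoped TensorProduct LaurentPolynomial

noncomputable section

namespace HTConf

/-! ### The bracket on coinvariants -/

section Bracket

variable {C : Type*} [AddCommGroup C] [Module ℂ C] [Module HT C]

/-! The singular vertex operator of a conformal algebra is the generating series of its products:
`f_n g` is the coefficient of the simple pole at `τ = n`, and no other poles occur. A functional in
`H_T^*` acts on the pole at `n` through its value on `T ^ n`, and the value of `Y_Hol(p) q` there is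
`(T ^ n p) q`. The prescribed operator on `LC` therefore amounts to the products `(f ⊗ p)_n (g ⊗ q)
= f_n g ⊗ (T ^ n p) q` (`yAff_eq_sum`).

These products satisfy the axioms because `K` is commutative and each `T ^ n` acts on it by an
algebra automorphism: on pure tensors every axiom becomes the axiom of `C` tensored with an identity
in `K`. Uniqueness follows because the poles are linearly independent, so the coefficients recover
the products (`lTensor_polarCoeff_ySing`), and pure tensors span `LC`.

The Lie bracket exists for any conformal algebra. Since `Δ*[0]` is the constant sequence `1`, the
product `f_⟨0⟩ g` is the sum of all `f_n g`. Summing the axioms over all indices makes it invariant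
under translation of `f`, equivariant in `g`, a derivation of itself (`angleZero_jacobi`), and skew
modulo `𝔪C` (`bracket_skew`). Hence it descends to a Lie bracket on coinvariants. For `LC` the
bracket is `∑ Tr (f_k g ⊗ (T ^ k p) q)`, and expanding `T ^ k` in the difference basis (`Tp_eq_sum`)
regroups this sum into the stated formula. -/

theorem deltaDual_zero (n : ℤ) : deltaDual 0 n = 1 := by
  change (if 0 = 0 ∨ 0 ≤ n then ∏ j ∈ Finset.range 0, ((n : ℂ) - j) else 0) = 1
  simp

namespace ConformalAlgebra

theorem angle_zero_eq_finsum (A : ConformalAlgebra C) (f g : C) :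
    A.angle 0 f g = ∑ᶠ n : ℤ, A.prod n f g := by
  simp only [angle, dualProd, deltaDual_zero, one_smul]

/-- The product `(f, g) ↦ f_⟨0⟩ g` as a bilinear map. -/
def angleZero (A : ConformalAlgebra C) : C →ₗ[ℂ] C →ₗ[ℂ] C :=
  LinearMap.mk₂ ℂ (A.angle 0)
    (fun f f' g => by
      simp only [angle_zero_eq_finsum, map_add, LinearMap.add_apply]
      exact finsum_add_distrib (A.finite f g) (A.finite f' g))
    (fun c f g => by
      simp only [angle_zero_eq_finsum, map_smul, LinearMap.smul_apply]
      exact (smul_finsum' c (A.finite f g)).symm)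
    (fun f g g' => by
      simp only [angle_zero_eq_finsum, map_add]
      exact finsum_add_distrib (A.finite f g) (A.finite f g'))
    (fun c f g => by
      simp only [angle_zero_eq_finsum, map_smul]
      exact (smul_finsum' c (A.finite f g)).symm)

theorem angleZero_apply (A : ConformalAlgebra C) (f g : C) :
    A.angleZero f g = ∑ᶠ n : ℤ, A.prod n f g :=
  A.angle_zero_eq_finsum f g

theorem Tp_smul_Tp_smul {M : Type*} [AddCommGroup M] [Module HT M] (m n : ℤ) (f : M) : Tp m • Tp n • f = Tp (m + n) • f := by
  rw [smul_smul, ← LaurentPolynomial.T_add]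

/-- Skew-symmetry moves `g` to the left slot, where covariance applies; a second use of
skew-symmetry moves it back. -/
theorem prod_Tp_smul (A : ConformalAlgebra C) (f g : C) (n p : ℤ) :
    A.prod n f (Tp p • g) = Tp p • A.prod (n - p) f g := by
  rw [A.skew f, A.covariance, A.skew f g, smul_neg, Tp_smul_Tp_smul]
  congr 3 <;> ring_nf

/-- Covariance only shifts the index, which a sum over all of `ℤ` does not see. -/
theorem angleZero_Tp_smul_left (A : ConformalAlgebra C) (f g : C) (p : ℤ) :
    A.angleZero (Tp p • f) g = A.angleZero f g := by
  simp only [angleZero_apply, A.covariance]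
  exact finsum_comp_equiv (Equiv.addRight p) (f := fun n => A.prod n f g)

theorem angleZero_Tp_smul_right (A : ConformalAlgebra C) (f g : C) (p : ℤ) :
    A.angleZero f (Tp p • g) = Tp p • A.angleZero f g := by
  simp only [angleZero_apply, prod_Tp_smul]
  rw [smul_finsum' _ (A.finite f g)]
  exact finsum_comp_equiv (Equiv.subRight p) (f := fun n => Tp p • A.prod n f g)

/-- This is the commutator axiom summed over all `m` and `n`. Finiteness of the products justifies
every interchange of a sum with a product or a difference. -/
theorem angleZero_jacobi (A : ConformalAlgebra C) (f g k : C) :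
    A.angleZero f (A.angleZero g k) - A.angleZero g (A.angleZero f k) =
      A.angleZero (A.angleZero f g) k := by
  have h1 : A.angleZero f (A.angleZero g k) = ∑ᶠ n, A.angleZero f (A.prod n g k) := by
    rw [A.angleZero_apply g k]
    exact (A.angleZero f).toAddMonoidHom.map_finsum (A.finite g k)
  rw [h1, A.angleZero_apply g (A.angleZero f k), A.angleZero_apply (A.angleZero f g) k,
    ← finsum_sub_distrib _ (A.finite _ _)]
  · refine finsum_congr fun n => ?_
    have h2 : A.prod n g (A.angleZero f k) = ∑ᶠ m, A.prod n g (A.prod m f k) := by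
      rw [A.angleZero_apply f k]
      exact (A.prod n g).toAddMonoidHom.map_finsum (A.finite f k)
    have h3 : A.prod n (A.angleZero f g) k = ∑ᶠ m, A.prod n (A.prod m f g) k := by
      rw [A.angleZero_apply f g]
      exact ((A.prod n).flip k).toAddMonoidHom.map_finsum (A.finite f g)
    rw [h2, h3, A.angleZero_apply f (A.prod n g k), ← finsum_sub_distrib (A.finite _ _)]
    · simp only [A.commutator]
      -- For fixed `n`, the substitution `m ↦ m - n` absorbs the shift in the commutator axiom.
      exact finsum_comp_equiv (Equiv.subRight n) (f := fun m => A.prod n (A.prod m f g) k)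
    · refine (A.finite f k).subset fun m hm h => hm ?_
      simp only [h, map_zero]
  · refine (A.finite g k).subset fun n hn h => hn ?_
    simp only [h, map_zero]

end ConformalAlgebra

/-! ### Descent to coinvariants -/

variable [IsScalarTower ℂ HT C]

theorem Tr_Tp_smul (n : ℤ) (f : C) : Tr (Tp n • f) = Tr f := by
  refine (Submodule.Quotient.eq _).2 ?_
  have h : Tp n • f - f = (Tp n - 1) • f := by rw [sub_smul, one_smul]
  rw [h]
  refine Submodule.smul_mem_smul ?_ Submodule.mem_top
  rw [augIdeal, RingHom.mem_ker, map_sub, map_one, Bialgebra.counitAlgHom_apply,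
    LaurentPolynomial.counit_T, sub_self]

/-- A linear map which is invariant under the translations vanishes on `𝔪M`. -/
theorem map_eq_zero_of_mem_augIdeal_smul {V : Type*} [AddCommGroup V] [Module ℂ V]
    (φ : C →ₗ[ℂ] V) (hφ : ∀ (n : ℤ) (f : C), φ (Tp n • f) = φ f) {x : C}
    (hx : x ∈ augIdeal • (⊤ : Submodule HT C)) : φ x = 0 := by
  -- The `T ^ n` span `H_T` and have counit `1`, so invariance under them means that all of `H_T`
  -- acts through the counit, which vanishes on `𝔪`.
  have key : ∀ (h : HT) (f : C), φ (h • f) = Bialgebra.counitAlgHom ℂ HT h • φ f := by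
    intro h f
    induction h using LaurentPolynomial.induction_on' with
    | add a b ha hb => rw [add_smul, map_add, ha, hb, map_add, add_smul]
    | C_mul_T n c =>
      rw [← LaurentPolynomial.smul_eq_C_mul, smul_assoc, map_smul, hφ, map_smul,
        Bialgebra.counitAlgHom_apply, LaurentPolynomial.counit_T, smul_eq_mul, mul_one]
  induction hx using Submodule.smul_induction_on' with
  | smul h hh f _ => rw [key, show Bialgebra.counitAlgHom ℂ HT h = 0 from hh, zero_smul]
  | add x _ y _ hx hy => rw [map_add, hx, hy, add_zero]

/-- The map on coinvariants induced by a translation invariant linear map. -/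
def coinvLift {V : Type*} [AddCommGroup V] [Module ℂ V] (φ : C →ₗ[ℂ] V)
    (hφ : ∀ (n : ℤ) (f : C), φ (Tp n • f) = φ f) : Coinv C →ₗ[ℂ] V :=
  (((augIdeal • (⊤ : Submodule HT C)).restrictScalars ℂ).liftQ φ fun _ hx =>
    map_eq_zero_of_mem_augIdeal_smul φ hφ hx) ∘ₗ
    (Submodule.Quotient.restrictScalarsEquiv ℂ (augIdeal • (⊤ : Submodule HT C))).symm.toLinearMap

theorem coinvLift_Tr {V : Type*} [AddCommGroup V] [Module ℂ V] (φ : C →ₗ[ℂ] V)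
    (hφ : ∀ (n : ℤ) (f : C), φ (Tp n • f) = φ f) (f : C) : coinvLift φ hφ (Tr f) = φ f := rfl

theorem Tr_surjective : Function.Surjective (Tr : C →ₗ[ℂ] Coinv C) :=
  Submodule.mkQ_surjective (augIdeal • (⊤ : Submodule HT C))

namespace ConformalAlgebra

/-- The map `(x, f) ↦ Tr (x_⟨0⟩ f)` descended to coinvariants in the second variable. -/
def bracketRight (A : ConformalAlgebra C) : C →ₗ[ℂ] Coinv C →ₗ[ℂ] Coinv C :=
  -- `coinvLift` descends the first argument, so the map is flipped beforehand and flipped back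
  -- afterwards.
  LinearMap.flip <| coinvLift (A.angleZero.compr₂ Tr).flip fun n g =>
    LinearMap.ext fun f => by
      rw [LinearMap.flip_apply, LinearMap.flip_apply, LinearMap.compr₂_apply,
        LinearMap.compr₂_apply, angleZero_Tp_smul_right, Tr_Tp_smul]

theorem bracketRight_Tr (A : ConformalAlgebra C) (f g : C) :
    A.bracketRight f (Tr g) = Tr (A.angleZero f g) := by
  rw [bracketRight, LinearMap.flip_apply, coinvLift_Tr, LinearMap.flip_apply,
    LinearMap.compr₂_apply]

/-- The bracket `[Tr x, Tr y] = Tr (x_⟨0⟩ y)` on the coinvariants of a conformal algebra. -/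
def bracket (A : ConformalAlgebra C) : Coinv C →ₗ[ℂ] Coinv C →ₗ[ℂ] Coinv C :=
  coinvLift A.bracketRight fun n f => LinearMap.ext fun y => by
    obtain ⟨g, rfl⟩ := Tr_surjective y
    rw [bracketRight_Tr, bracketRight_Tr, angleZero_Tp_smul_left]

theorem bracket_Tr (A : ConformalAlgebra C) (f g : C) :
    A.bracket (Tr f) (Tr g) = Tr (A.angleZero f g) := by
  rw [bracket, coinvLift_Tr, bracketRight_Tr]

/-- `Tr` erases the factor `T ^ n` in the skew-symmetry axiom, and `n ↦ -n` permutes the index set.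
-/
theorem bracket_skew (A : ConformalAlgebra C) (x y : Coinv C) :
    A.bracket x y = -A.bracket y x := by
  obtain ⟨f, rfl⟩ := Tr_surjective x
  obtain ⟨g, rfl⟩ := Tr_surjective y
  have hmap : ∀ f g : C, Tr (A.angleZero f g) = ∑ᶠ n, Tr (A.prod n f g) := fun f g => by
    rw [angleZero_apply]
    exact Tr.toAddMonoidHom.map_finsum (A.finite f g)
  rw [bracket_Tr, bracket_Tr, hmap, hmap, ← finsum_neg_distrib]
  rw [← finsum_comp_equiv (Equiv.neg ℤ) (f := fun n => -Tr (A.prod n g f))]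
  refine finsum_congr fun n => ?_
  rw [A.skew f g n, map_neg, Tr_Tp_smul]
  rfl

theorem isLieBracket_bracket (A : ConformalAlgebra C) : IsLieBracket A.bracket where
  alternating x := by
    have h : (2 : ℂ) • A.bracket x x = 0 := by
      rw [two_smul]
      exact add_eq_zero_iff_eq_neg.2 (A.bracket_skew x x)
    rw [← inv_smul_smul₀ (two_ne_zero (α := ℂ)) (A.bracket x x), h, smul_zero]
  jacobi x y z := by
    obtain ⟨f, rfl⟩ := Tr_surjective x
    obtain ⟨g, rfl⟩ := Tr_surjective y
    obtain ⟨k, rfl⟩ := Tr_surjective z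
    have h := congrArg Tr (A.angleZero_jacobi f g k)
    rw [map_sub] at h
    simp only [← bracket_Tr] at h
    -- Two uses of skew-symmetry bring the cyclic Jacobi identity to the Leibniz form `h`.
    rw [A.bracket_skew (Tr k) (Tr f), map_neg, A.bracket_skew (Tr k), ← h]
    abel

end ConformalAlgebra

end Bracket

/-! ### The conformal structure on the affinization -/

section AffinizationStructure

variable {C : Type*} [AddCommGroup C] [Module ℂ C]

@[elab_as_elim]
theorem Affinization.induction_on {motive : Affinization C → Prop} (x : Affinization C)
    (zero : motive 0) (aff : ∀ f p, motive (aff f p))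
    (add : ∀ x y, motive x → motive y → motive (x + y)) : motive x :=
  TensorProduct.induction_on (motive := motive) x zero aff add

theorem Affinization.hom_ext₂ {V : Type*} [AddCommGroup V] [Module ℂ V]
    {φ ψ : Affinization C →ₗ[ℂ] Affinization C →ₗ[ℂ] V}
    (h : ∀ f p g q, φ (aff f p) (aff g q) = ψ (aff f p) (aff g q)) : φ = ψ := by
  ext x y
  induction x using Affinization.induction_on with
  | zero => simp
  | add x x' hx hx' => simp only [map_add, LinearMap.add_apply, hx, hx']
  | aff f p =>
    induction y using Affinization.induction_on with
    | zero => simp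
    | add y y' hy hy' => simp only [map_add, hy, hy']
    | aff g q => exact h f p g q

variable [Module HT C]

/-- The products `(f ⊗ p)_n (g ⊗ q) = f_n g ⊗ (T ^ n p) q` on the affinization. -/
def ConformalAlgebra.affProd (A : ConformalAlgebra C) (n : ℤ) :
    Affinization C →ₗ[ℂ] Affinization C →ₗ[ℂ] Affinization C :=
  TensorProduct.map₂ (A.prod n) ((LinearMap.mul ℂ K).comp (shiftK n).toLinearMap)

namespace ConformalAlgebra

theorem affProd_aff (A : ConformalAlgebra C) (n : ℤ) (f g : C) (p q : K) :
    A.affProd n (aff f p) (aff g q) = aff (A.prod n f g) ((Tp n • p) * q) := by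
  rw [Tp_smul]; rfl

theorem Tp_zero_smul (p : K) : Tp 0 • p = p := one_smul HT p

theorem aff_zero_left {M : Type*} [AddCommGroup M] [Module ℂ M] (p : K) : aff (0 : M) p = 0 :=
  TensorProduct.zero_tmul M p

theorem Tp_smul_mul (n : ℤ) (p q : K) : Tp n • (p * q) = (Tp n • p) * (Tp n • q) := by
  simp only [Tp_smul, map_mul]

/-! ### Singular vertex operators as generating series of the products -/

theorem ySing_eq_sum {M : Type*} [AddCommGroup M] [Module ℂ M] [Module HT M]
    (B : ConformalAlgebra M) (f g : M) (s : Finset ℤ) (hs : ∀ n, B.prod n f g ≠ 0 → n ∈ s) :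
    B.ySing f g = ∑ n ∈ s, B.prod n f g ⊗ₜ[ℂ] pole (n, 0) := by
  rw [ySing, finsum_eq_sum_of_support_subset (s := s)]
  · simp only [antip_smul_invTau]
  · refine fun n hn => hs n fun h => hn ?_
    change B.prod n f g ⊗ₜ[ℂ] _ = 0
    rw [h, TensorProduct.zero_tmul]

/-- The products can be read off from the singular vertex operator. -/
theorem lTensor_polarCoeff_ySing {M : Type*} [AddCommGroup M] [Module ℂ M] [Module HT M]
    (B : ConformalAlgebra M) (f g : M) (n : ℤ) :
    TensorProduct.rid ℂ M ((polarCoeff (n, 0)).lTensor M (B.ySing f g)) = B.prod n f g := by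
  classical
  -- Inserting `n` makes the `n`-th term available even when that product vanishes.
  rw [B.ySing_eq_sum f g (insert n (B.finite f g).toFinset) fun m hm =>
    Finset.mem_insert_of_mem ((B.finite f g).mem_toFinset.2 hm), map_sum, map_sum,
    Finset.sum_eq_single_of_mem n (Finset.mem_insert_self _ _)]
  · simp [polarCoeff_pole]
  · intro m _ hm
    simp [polarCoeff_pole, hm.symm]

/-- Each class `S(T ^ n) (1 / τ)` is an element of `polarBasis`, on which `holAct` evaluates its
functional at `T ^ n`. No expansion in the difference basis is needed, and `sing` returns the class
to the pole itself. -/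
theorem yAff_eq_sum (A : ConformalAlgebra C) (f g : C) (p q : K) (s : Finset ℤ)
    (hs : ∀ n, A.prod n f g ≠ 0 → n ∈ s) :
    A.yAff f p g q = ∑ n ∈ s, aff (A.prod n f g) ((Tp n • p) * q) ⊗ₜ[ℂ] pole (n, 0) := by
  rw [yAff, A.ySing_eq_sum f g s hs, dotTensor]
  simp only [map_sum]
  refine Finset.sum_congr rfl fun n _ => ?_
  rw [LinearMap.lTensor_tmul, LinearMap.comp_apply, ← polarBasis_apply, holAct,
    Module.Basis.constr_basis, TensorProduct.assoc_symm_tmul, LinearMap.rTensor_tmul,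
    LinearMap.lTensor_tmul, sing_polarBasis]
  rfl

/-! ### The conformal algebra axioms on the affinization -/

variable [IsScalarTower ℂ HT C]

/-- Translation on an `H_T`-module as a linear map over `ℂ`. -/
def translation (M : Type*) [AddCommGroup M] [Module ℂ M] [Module HT M] [IsScalarTower ℂ HT M]
    (n : ℤ) : M →ₗ[ℂ] M := Algebra.lsmul ℂ ℂ M (Tp n)

/-- The conformal algebra structure on the affinization. -/
def affinization (A : ConformalAlgebra C) : ConformalAlgebra (Affinization C) where
  prod := A.affProd
  finite x y := by
    induction x using Affinization.induction_on with
    | zero => simp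
    | add x x' hx hx' =>
      refine (hx.union hx').subset fun n hn => ?_
      by_contra h
      simp only [Set.mem_union, Set.mem_ofPred_eq, not_or, not_not] at h
      exact hn (by rw [map_add, LinearMap.add_apply, h.1, h.2, add_zero])
    | aff f p =>
      induction y using Affinization.induction_on with
      | zero => simp
      | add y y' hy hy' =>
        refine (hy.union hy').subset fun n hn => ?_
        by_contra h
        simp only [Set.mem_union, Set.mem_ofPred_eq, not_or, not_not] at h
        exact hn (by rw [map_add, h.1, h.2, add_zero])
      | aff g q =>
        refine (A.finite f g).subset fun n hn h => hn ?_
        rw [affProd_aff, h, aff_zero_left]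
  covariance x y n k := by
    have : (A.affProd n).comp (translation _ k) = A.affProd (n + k) := by
      refine Affinization.hom_ext₂ fun f p g q => ?_
      change A.affProd n (Tp k • aff f p) (aff g q) = _
      rw [Tp_smul_aff, affProd_aff, affProd_aff, A.covariance, Tp_smul_Tp_smul]
    exact LinearMap.congr_fun₂ this x y
  skew x y n := by
    -- Stated between bilinear maps, the axiom need only be tested on pure tensors. There `T ^ n ((T
    -- ^ (-n) q) p) = q (T ^ n p)`, and commutativity of `K` finishes.
    have : A.affProd n = -((A.affProd (-n)).compr₂ (translation _ n)).flip := by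
      refine Affinization.hom_ext₂ fun f p g q => ?_
      change _ = -(Tp n • A.affProd (-n) (aff g q) (aff f p))
      rw [affProd_aff, affProd_aff, Tp_smul_aff, A.skew f g, Tp_smul_mul, Tp_smul_Tp_smul,
        add_neg_cancel, Tp_zero_smul, mul_comm q]
      exact TensorProduct.neg_tmul _ _
    exact LinearMap.congr_fun₂ this x y
  commutator x y z m n := by
    induction x using Affinization.induction_on with
    | zero => simp
    | add x x' hx hx' =>
      simp only [map_add, LinearMap.add_apply, ← hx, ← hx']; abel
    | aff f p =>
      -- The axiom is trilinear: with the first argument reduced to a pure tensor, both sides are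
      -- bilinear in the other two, so `Affinization.hom_ext₂` applies once the compositions are
      -- written with `LinearMap.llcomp`.
      have : (A.affProd m (aff f p)).comp (A.affProd n y) -
          (A.affProd n y).comp (A.affProd m (aff f p)) =
          A.affProd n (A.affProd (m - n) (aff f p) y) := by
        have : (LinearMap.llcomp ℂ _ _ _ (A.affProd m (aff f p))).comp (A.affProd n) -
            ((LinearMap.llcomp ℂ _ _ _).flip (A.affProd m (aff f p))).comp (A.affProd n) =
            (A.affProd n).comp (A.affProd (m - n) (aff f p)) := by
          refine Affinization.hom_ext₂ fun g q k r => ?_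
          change A.affProd m (aff f p) (A.affProd n (aff g q) (aff k r)) -
            A.affProd n (aff g q) (A.affProd m (aff f p) (aff k r)) =
            A.affProd n (A.affProd (m - n) (aff f p) (aff g q)) (aff k r)
          simp only [affProd_aff]
          -- All three terms carry the same factor `(T ^ m p) (T ^ n q) r` in `K`; on the right it
          -- arises from `T ^ n ((T ^ (m - n) p) q) r`.
          rw [← A.commutator f g k m n, Tp_smul_mul, Tp_smul_Tp_smul, add_sub_cancel,
            ← mul_assoc (Tp m • p), mul_left_comm (Tp n • q), ← mul_assoc (Tp m • p)]
          exact (TensorProduct.sub_tmul _ _ _).symm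
        exact LinearMap.congr_fun this y
      exact LinearMap.congr_fun this z

theorem affinization_prod_aff (A : ConformalAlgebra C) (n : ℤ) (f g : C) (p q : K) :
    A.affinization.prod n (aff f p) (aff g q) = aff (A.prod n f g) ((Tp n • p) * q) :=
  A.affProd_aff n f g p q

/-! ### Characterization by the vertex operator, and the commutator formula -/

theorem ySing_affinization (A : ConformalAlgebra C) (f g : C) (p q : K) :
    A.affinization.ySing (aff f p) (aff g q) = A.yAff f p g q := by
  have hs : ∀ n, A.prod n f g ≠ 0 → n ∈ (A.finite f g).toFinset := fun n hn =>
    (A.finite f g).mem_toFinset.2 hn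
  rw [A.yAff_eq_sum f g p q _ hs, ySing_eq_sum _ _ _ (A.finite f g).toFinset]
  · simp only [affinization_prod_aff]
  · refine fun n hn => hs n fun h => hn ?_
    rw [affinization_prod_aff, h, aff_zero_left]

theorem eq_of_ySing_aff_eq (B B' : ConformalAlgebra (Affinization C))
    (h : ∀ (f g : C) (p q : K), B.ySing (aff f p) (aff g q) = B'.ySing (aff f p) (aff g q)) :
    B = B' := by
  refine ConformalAlgebra.ext (funext fun n => Affinization.hom_ext₂ fun f p g q => ?_)
  rw [← B.lTensor_polarCoeff_ySing, ← B'.lTensor_polarCoeff_ySing, h]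

/-- Both sides are the same double sum of `Δ*[n](T ^ k)` times `Tr (f_k g ⊗ (Δ[n] p) q)`: summing
over `n` first gives `T ^ k`, summing over `k` first gives `f_⟨n⟩ g`. -/
theorem bracket_trAff (A : ConformalAlgebra C) (f g : C) (p q : K) :
    A.affinization.bracket (trAff f p) (trAff g q) =
      ∑ᶠ n : ℤ, trAff (A.angle n f g) ((delta n • p) * q) := by
  obtain ⟨N, hN⟩ := A.exists_bound f g
  -- The bilinear form of `trAff`, so that finite sums and scalars can be pulled out of either slot.
  let tr : C →ₗ[ℂ] K →ₗ[ℂ] Coinv (Affinization C) := (TensorProduct.mk ℂ C K).compr₂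
    (Tr.comp (affEquiv (M := C)).toLinearMap)
  have htr : ∀ f p, trAff f p = tr f p := fun _ _ => rfl
  have h1 : A.affinization.bracket (trAff f p) (trAff g q) =
      ∑ k ∈ Finset.Icc (-(N : ℤ)) N, tr (A.prod k f g) ((Tp k • p) * q) := by
    rw [trAff, trAff, bracket_Tr, angleZero_apply,
      finsum_eq_sum_of_support_subset (s := Finset.Icc (-(N : ℤ)) N), map_sum]
    · simp only [affinization_prod_aff]
      rfl
    · refine fun k hk => hN k fun h => hk ?_
      change A.affinization.prod k (aff f p) (aff g q) = 0
      rw [affinization_prod_aff, h, aff_zero_left]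
  -- One bound `N` serves both indices: `Δ*[n](T ^ k)` vanishes when `|k| < |n|`, so `f_⟨n⟩ g` is
  -- zero outside the same interval.
  rw [h1, finsum_eq_sum_of_support_subset (s := Finset.Icc (-(N : ℤ)) N)]
  · simp only [htr, A.angle_eq_sum f g N hN, map_sum, LinearMap.sum_apply]
    rw [Finset.sum_comm]
    refine Finset.sum_congr rfl fun k hk => ?_
    rw [Tp_eq_sum k N (abs_le.2 (Finset.mem_Icc.1 hk)), Finset.sum_smul, Finset.sum_mul, map_sum]
    refine Finset.sum_congr rfl fun n _ => ?_
    rw [smul_assoc, smul_mul_assoc, map_smul, map_smul, LinearMap.smul_apply]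
  · refine fun n hn => A.angle_support f g N hN n fun h => hn ?_
    change trAff (A.angle n f g) _ = 0
    rw [htr, h, map_zero, LinearMap.zero_apply]

end ConformalAlgebra

end AffinizationStructure

end HTConf

end

theorem mainTheorem10 {C : Type*} [AddCommGroup C] [Module ℂ C] [Module HTConf.HT C]
    [IsScalarTower ℂ HTConf.HT C] (A : HTConf.ConformalAlgebra C) :
    ∃ B : HTConf.ConformalAlgebra (HTConf.Affinization C),
      (∀ (f g : C) (p q : HTConf.K),
        B.ySing (HTConf.aff f p) (HTConf.aff g q) = A.yAff f p g q) ∧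
      (∀ B' : HTConf.ConformalAlgebra (HTConf.Affinization C),
        (∀ (f g : C) (p q : HTConf.K),
          B'.ySing (HTConf.aff f p) (HTConf.aff g q) = A.yAff f p g q) → B' = B) ∧
      ∃ br : HTConf.Coinv (HTConf.Affinization C) →ₗ[ℂ]
          HTConf.Coinv (HTConf.Affinization C) →ₗ[ℂ] HTConf.Coinv (HTConf.Affinization C),
        HTConf.IsLieBracket br ∧
        (∀ x y : HTConf.Affinization C,
          br (HTConf.Tr x) (HTConf.Tr y) = HTConf.Tr (B.angle 0 x y)) ∧
        ∀ (f g : C) (p q : HTConf.K),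
          br (HTConf.trAff f p) (HTConf.trAff g q) =
            ∑ᶠ n : ℤ, HTConf.trAff (A.angle n f g) ((HTConf.delta n • p) * q) := by
  refine ⟨A.affinization, A.ySing_affinization, fun B' hB' => ?_, A.affinization.bracket,
    A.affinization.isLieBracket_bracket, fun x y => A.affinization.bracket_Tr x y, A.bracket_trAff⟩
  exact HTConf.ConformalAlgebra.eq_of_ySing_aff_eq _ _ fun f g p q => by
    rw [hB', A.ySing_affinization]
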